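/- Let $q\in\mathbb{C}$ with $|q|<1$. Write $(a;q)_n=\prod_{j=0}^{n-1}(1-aq^j)$, $(a;q)_\infty=\prod_{j\ge 0}(1-aq^j)$, $(a,b,c;q)_\infty=(a;q)_\infty(b;q)_\infty(c;q)_\infty$, and let ${n\brack k}_q=\frac{(q;q)_n}{(q;q)_k(q;q)_{n-k}}$ for $0\le k\le n$. Then the following three series over $n$ converge absolutely, and $$\sum_{n=0}^{\infty}\ \sum_{m=-\lfloor n/2\rfloor}^{\lfloor n/2\rfloor}\frac{(-1)^m q^{n^2+m(9m+1)/2}}{(q;q^2)_n\,(q^4;q^4)_n}{2n\brack n-2m}_{q^2}=\frac{(-q;q^2)_\infty\,(q^8,q^9,q^{17};q^{17})_\infty}{(q^2;q^2)_\infty},$$ $$\sum_{n=0}^{\infty}\ \sum_{m=-\lfloor n/2\rfloor}^{\lfloor n/2\rfloor}\frac{(-1)^m q^{2n(n+1)+m(9m+1)/2}}{(1+q^{2n+1})\,(q^2;q^2)_{2n}}{2n\brack n-2m}_{q^2}=\frac{1}{(q^2;q^2)_\infty}\Big((q^8,q^{17},q^{25};q^{25})_\infty-q\,(q^4,q^{21},q^{25};q^{25})_\infty\Big),$$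 $$\sum_{n=0}^{\infty}\ \sum_{m=-\lfloor n/2\rfloor}^{\lfloor n/2\rfloor}\frac{(-1)^m q^{n(n+1)+m(9m+1)/2}}{(q;q)_{2n}\,(-q;q^2)_{n+1}}{2n\brack n-2m}_{q^2}=\frac{(-q^2;q^2)_\infty}{(q^2;q^2)_\infty}\Big((q^6,q^{11},q^{17};q^{17})_\infty-q\,(q^2,q^{15},q^{17};q^{17})_\infty\Big).$$ -/

import Mathlib

noncomputable section

/-- The finite `q`-shifted factorial `(a; q)_n = ∏_{j=0}^{n-1} (1 - a q^j)`. -/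
def qPoch (a q : ℂ) (n : ℕ) : ℂ :=
  ∏ j ∈ Finset.range n, (1 - a * q ^ j)

/-- The infinite `q`-shifted factorial `(a; q)_∞ = ∏_{n ≥ 0} (1 - a q^n)`,
which converges for `|q| < 1` by `qPochInf_multipliable`. -/
def qPochInf (a q : ℂ) : ℂ :=
  ∏' n : ℕ, (1 - a * q ^ n)

theorem qPochInf_multipliable (a : ℂ) {q : ℂ} (hq : ‖q‖ < 1) :
    Multipliable fun n : ℕ => 1 - a * q ^ n := by
  have h : Summable fun n : ℕ => ‖-(a * q ^ n)‖ := by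
    simp only [norm_neg, norm_mul, norm_pow]
    exact (summable_geometric_of_lt_one (norm_nonneg q) hq).mul_left _
  simpa [sub_eq_add_neg] using multipliable_one_add_of_summable h

/-- The compact notation `(a, b, c; q)_∞ = (a; q)_∞ (b; q)_∞ (c; q)_∞`. -/
def qPochInf3 (a b c q : ℂ) : ℂ :=
  qPochInf a q * qPochInf b q * qPochInf c q

/-- The Gaussian binomial coefficient `(q; q)_n / ((q; q)_k (q; q)_{n-k})` for `0 ≤ k ≤ n`,
and `0` for every other integer `k`. -/
def gaussBinom (q : ℂ) (n : ℕ) (k : ℤ) : ℂ :=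
  if 0 ≤ k ∧ k ≤ (n : ℤ) then
    qPoch q q n / (qPoch q q k.toNat * qPoch q q (n - k.toNat))
  else 0

end

noncomputable section

open Filter Topology

/-! Put p = q². Since the Gaussian binomial is (p;p)_{2n} times 1/((p;p)_{n-2m} (p;p)_{n+2m}), each
series has the form ∑ₙ Wₙ ∑ₘ θₘ κ(n,m). Here θₘ = (-1)^m q^{m(9m+1)/2} and κ is that product of
reciprocals, with an extra 1/(1+q^{2n+1}) in the last two series. The sums are interchanged. The
n-sum is a conjugate Bailey pair coming from a limiting q-Gauss sum
(`hasSum_gaussNum_mul_recipPoch`), and it only adds a quadratic to the exponent of q. The remaining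
m-sum is a theta series, evaluated by the Jacobi triple product (`hasSum_thetaTerm`). The factor
1/(1+q^{2n+1}) is removed by a telescoping identity (`recipPoch_telescope`), which turns the kernel
relative to 1 into one relative to p. It applies because m and -(m+1) can be paired: θₘ = q^{4m²}εₘ
with εₘ odd under this reflection. Two telescoping steps per pair produce four terms, which regroup
into a difference of two theta series. `HasSum` over ℂ is unconditional, hence absolute,
convergence. -/

/-! ### Finite and infinite q-shifted factorials -/

theorem qPoch_zero (a q : ℂ) : qPoch a q 0 = 1 := by simp [qPoch]

theorem qPoch_succ (a q : ℂ) (n : ℕ) : qPoch a q (n + 1) = qPoch a q n * (1 - a * q ^ n) := by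
  simp [qPoch, Finset.prod_range_succ]

theorem qPoch_add (a q : ℂ) (m n : ℕ) :
    qPoch a q (m + n) = qPoch a q m * qPoch (a * q ^ m) q n := by
  simp only [qPoch, Finset.prod_range_add]
  congr 1
  refine Finset.prod_congr rfl fun j _ => ?_
  ring

theorem one_sub_mul_pow_ne_zero {a q : ℂ} (ha : ‖a‖ < 1) (hq : ‖q‖ < 1) (n : ℕ) :
    1 - a * q ^ n ≠ 0 := by
  intro h
  have h1 : ‖a * q ^ n‖ = 1 := by rw [← sub_eq_zero.mp h, norm_one]
  have h2 : ‖a * q ^ n‖ ≤ ‖a‖ := by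
    rw [norm_mul, norm_pow]
    exact mul_le_of_le_one_right (norm_nonneg _) (pow_le_one₀ (norm_nonneg _) hq.le)
  linarith

theorem qPoch_ne_zero {a q : ℂ} (ha : ‖a‖ < 1) (hq : ‖q‖ < 1) (n : ℕ) : qPoch a q n ≠ 0 :=
  Finset.prod_ne_zero_iff.mpr fun j _ => one_sub_mul_pow_ne_zero ha hq j

theorem tendsto_qPoch (a : ℂ) {q : ℂ} (hq : ‖q‖ < 1) :
    Tendsto (qPoch a q) atTop (𝓝 (qPochInf a q)) :=
  (qPochInf_multipliable a hq).tendsto_prod_tprod_nat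

theorem qPochInf_ne_zero {a q : ℂ} (ha : ‖a‖ < 1) (hq : ‖q‖ < 1) : qPochInf a q ≠ 0 := by
  have h : Summable fun n : ℕ => ‖-(a * q ^ n)‖ := by
    simp only [norm_neg, norm_mul, norm_pow]
    exact (summable_geometric_of_lt_one (norm_nonneg q) hq).mul_left _
  have := tprod_one_add_ne_zero_of_summable (f := fun n : ℕ => -(a * q ^ n))
    (fun n => by simpa [sub_eq_add_neg] using one_sub_mul_pow_ne_zero ha hq n) h
  simpa [qPochInf, sub_eq_add_neg] using this

theorem qPochInf_eq_mul (a : ℂ) {q : ℂ} (hq : ‖q‖ < 1) (n : ℕ) :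
    qPochInf a q = qPoch a q n * qPochInf (a * q ^ n) q := by
  refine tendsto_nhds_unique ((tendsto_qPoch a hq).comp (tendsto_add_atTop_nat n)) ?_
  refine ((tendsto_qPoch (a * q ^ n) hq).const_mul (qPoch a q n)).congr fun k => ?_
  simp only [Function.comp]
  rw [add_comm k n, qPoch_add]

theorem exists_qPoch_inv_bound {a q : ℂ} (ha : ‖a‖ < 1) (hq : ‖q‖ < 1) :
    ∃ C : ℝ, 0 ≤ C ∧ ∀ n, ‖(qPoch a q n)⁻¹‖ ≤ C := by
  have h := ((tendsto_qPoch a hq).inv₀ (qPochInf_ne_zero ha hq)).norm.bddAbove_range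
  obtain ⟨C, hC⟩ := h
  have hb : ∀ n, ‖(qPoch a q n)⁻¹‖ ≤ C := fun n => hC ⟨n, rfl⟩
  exact ⟨C, (norm_nonneg _).trans (hb 0), hb⟩

/-! ### The limiting q-Gauss sum -/

/-- The product `∏_{j < k} (c q^{2j} - b q^j)`, the numerator of the limiting `q`-Gauss series. -/
def gaussNum (c b q : ℂ) (k : ℕ) : ℂ :=
  ∏ j ∈ Finset.range k, (c * q ^ (2 * j) - b * q ^ j)

theorem gaussNum_zero (c b q : ℂ) : gaussNum c b q 0 = 1 := by simp [gaussNum]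

theorem gaussNum_succ (c b q : ℂ) (k : ℕ) :
    gaussNum c b q (k + 1) = gaussNum c b q k * (c * q ^ (2 * k) - b * q ^ k) := by
  simp [gaussNum, Finset.prod_range_succ]

theorem gaussNum_add (c b q : ℂ) (r k : ℕ) :
    gaussNum c b q (r + k) =
      gaussNum c b q r * gaussNum (c * q ^ (2 * r)) (b * q ^ r) q k := by
  simp only [gaussNum, Finset.prod_range_add]
  congr 1
  refine Finset.prod_congr rfl fun j _ => ?_
  ring

theorem summable_norm_gaussNum (c b : ℂ) {q : ℂ} (hq : ‖q‖ < 1) :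
    Summable fun k => ‖gaussNum c b q k‖ := by
  have h0 : Tendsto (fun k : ℕ => q ^ k) atTop (𝓝 0) :=
    tendsto_pow_atTop_nhds_zero_of_norm_lt_one hq
  have h1 : Tendsto (fun k : ℕ => ‖c * q ^ (2 * k) - b * q ^ k‖) atTop (𝓝 0) := by
    have := (((h0.pow 2).const_mul c).sub (h0.const_mul b)).norm
    simpa [← pow_mul, mul_comm] using this
  have h2 : ∀ᶠ k in atTop, ‖c * q ^ (2 * k) - b * q ^ k‖ < 1 / 2 :=
    h1.eventually (gt_mem_nhds (by norm_num))
  refine summable_of_ratio_norm_eventually_le (r := 1 / 2) (by norm_num) ?_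
  filter_upwards [h2] with k hk
  rw [norm_norm, norm_norm, gaussNum_succ, norm_mul, mul_comm]
  exact mul_le_mul_of_nonneg_right hk.le (norm_nonneg _)

/-- The shifted limiting `q`-Gauss series. -/
def gaussSeries (c b q : ℂ) (N : ℕ) : ℂ :=
  ∑' k : ℕ, q ^ (N * k) * gaussNum c b q k * (qPoch q q k)⁻¹ * (qPoch c q (N + k))⁻¹

theorem exists_gaussSeries_bound {c q : ℂ} (b : ℂ) (hc : ‖c‖ < 1) (hq : ‖q‖ < 1) :
    ∃ u : ℕ → ℝ, Summable u ∧ ∀ N M k : ℕ,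
      ‖q ^ (N * k) * gaussNum c b q k * (qPoch q q k)⁻¹ * (qPoch c q (M + k))⁻¹‖ ≤ u k := by
  obtain ⟨C, hC0, hC⟩ := exists_qPoch_inv_bound hq hq
  obtain ⟨D, hD0, hD⟩ := exists_qPoch_inv_bound hc hq
  refine ⟨fun k => ‖gaussNum c b q k‖ * C * D,
    ((summable_norm_gaussNum c b hq).mul_right C).mul_right D, fun N M k => ?_⟩
  rw [norm_mul, norm_mul, norm_mul, norm_pow]
  have h1 : ‖q‖ ^ (N * k) ≤ 1 := pow_le_one₀ (norm_nonneg _) hq.le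
  have h2 : ‖q‖ ^ (N * k) * ‖gaussNum c b q k‖ ≤ ‖gaussNum c b q k‖ :=
    mul_le_of_le_one_left (norm_nonneg _) h1
  exact mul_le_mul (mul_le_mul h2 (hC k) (norm_nonneg _) (norm_nonneg _)) (hD _) (norm_nonneg _)
    (mul_nonneg (norm_nonneg _) hC0)

theorem summable_gaussSeries {c q : ℂ} (b : ℂ) (hc : ‖c‖ < 1) (hq : ‖q‖ < 1) (N M : ℕ) :
    Summable fun k : ℕ =>
      q ^ (N * k) * gaussNum c b q k * (qPoch q q k)⁻¹ * (qPoch c q (M + k))⁻¹ := by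
  obtain ⟨u, hu, h⟩ := exists_gaussSeries_bound b hc hq
  exact Summable.of_norm_bounded hu fun k => h N M k

/-- The difference of the two summands telescopes in k. Iterating the relation from N = 0 splits off
(b;q)_N, and letting N → ∞ gives the q-Gauss sum. -/
theorem gaussSeries_eq {c q : ℂ} (b : ℂ) (hc : ‖c‖ < 1) (hq : ‖q‖ < 1) (N : ℕ) :
    gaussSeries c b q N = (1 - b * q ^ N) * gaussSeries c b q (N + 1) := by
  -- The telescoping certificate: the summand times 1 - q^k, which vanishes at k = 0.
  set t : ℕ → ℂ := fun k =>
    q ^ (N * k) * gaussNum c b q k * (qPoch q q k)⁻¹ * (qPoch c q (N + k))⁻¹ * (1 - q ^ k) with ht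
  have s0 := summable_gaussSeries b hc hq N N
  have s1 := summable_gaussSeries b hc hq (N + 1) (N + 1)
  have s2 := summable_gaussSeries b hc hq (N + 1) N
  have st : Summable t := by
    refine (s0.sub s2).congr fun k => ?_
    simp only [ht]
    ring
  have key : ∀ k,
      q ^ (N * k) * gaussNum c b q k * (qPoch q q k)⁻¹ * (qPoch c q (N + k))⁻¹ -
        (1 - b * q ^ N) * (q ^ ((N + 1) * k) * gaussNum c b q k * (qPoch q q k)⁻¹ *
          (qPoch c q (N + 1 + k))⁻¹) = t k - t (k + 1) := by
    intro k
    have e1 : qPoch c q (N + 1 + k) = qPoch c q (N + k) * (1 - c * q ^ (N + k)) := by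
      rw [show N + 1 + k = N + k + 1 by ring, qPoch_succ]
    have e2 : qPoch c q (N + (k + 1)) = qPoch c q (N + k) * (1 - c * q ^ (N + k)) := by
      rw [← add_assoc, qPoch_succ]
    have n1 := qPoch_ne_zero hc hq (N + k)
    have n2 := one_sub_mul_pow_ne_zero hc hq (N + k)
    have n3 := qPoch_ne_zero hq hq k
    have n4 := one_sub_mul_pow_ne_zero hq hq k
    have n5 : 1 - q ^ (k + 1) = 1 - q * q ^ k := by ring
    have n6 : q ^ ((N + 1) * k) = q ^ (N * k) * q ^ k := by ring
    have n7 : q ^ (N * (k + 1)) = q ^ (N * k) * q ^ N := by ring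
    have n8 : q ^ (2 * k) = q ^ k * q ^ k := by ring
    simp only [ht]
    rw [e1, e2, gaussNum_succ, qPoch_succ q q k, n5, n6, n7, n8]
    rw [pow_add] at n2 ⊢
    generalize q ^ k = x at *
    generalize q ^ (N * k) = y at *
    generalize q ^ N = z at *
    generalize hw : 1 - c * (z * x) = w at *
    generalize hv : 1 - q * x = v at *
    field_simp
    rw [← hw]
    ring
  have h0 : t 0 = 0 := by simp [ht]
  have hz : ∑' k, (t k - t (k + 1)) = 0 := by
    rw [st.tsum_sub ((summable_nat_add_iff 1).mpr st), st.tsum_eq_zero_add, h0]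
    ring
  rw [← sub_eq_zero, gaussSeries, gaussSeries, ← tsum_mul_left, ← s0.tsum_sub (s1.mul_left _), ← hz]
  exact tsum_congr key

/-- The factor q^{Nk} kills every term except k = 0; the bound uniform in N justifies the termwise
limit. -/
theorem tendsto_gaussSeries {c q : ℂ} (b : ℂ) (hc : ‖c‖ < 1) (hq : ‖q‖ < 1) :
    Tendsto (gaussSeries c b q) atTop (𝓝 (qPochInf c q)⁻¹) := by
  obtain ⟨u, hu, h⟩ := exists_gaussSeries_bound b hc hq
  have hlim : Tendsto (gaussSeries c b q) atTop
      (𝓝 (∑' k : ℕ, if k = 0 then (qPochInf c q)⁻¹ else 0)) := by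
    refine tendsto_tsum_of_dominated_convergence hu (fun k => ?_)
      (Eventually.of_forall fun N k => h N N k)
    have hP : Tendsto (fun N => (qPoch c q (N + k))⁻¹) atTop (𝓝 (qPochInf c q)⁻¹) :=
      ((tendsto_qPoch c hq).comp (tendsto_add_atTop_nat k)).inv₀ (qPochInf_ne_zero hc hq)
    rcases Nat.eq_zero_or_pos k with rfl | hk
    · simpa [gaussNum_zero, qPoch_zero] using hP
    · have h0 : Tendsto (fun N : ℕ => q ^ (N * k)) atTop (𝓝 0) := by
        have := (tendsto_pow_atTop_nhds_zero_of_norm_lt_one hq).pow k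
        simpa [← pow_mul, hk.ne'] using this
      simpa [hk.ne'] using ((h0.mul_const (gaussNum c b q k)).mul_const (qPoch q q k)⁻¹).mul hP
  simpa using hlim

/-- The limiting case of the `q`-Gauss sum. -/
theorem hasSum_gauss {c q : ℂ} (b : ℂ) (hc : ‖c‖ < 1) (hq : ‖q‖ < 1) :
    HasSum (fun k : ℕ => gaussNum c b q k * (qPoch q q k)⁻¹ * (qPoch c q k)⁻¹)
      (qPochInf b q / qPochInf c q) := by
  have s0 := summable_gaussSeries b hc hq 0 0
  have h1 : ∀ N, gaussSeries c b q 0 = qPoch b q N * gaussSeries c b q N := by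
    intro N
    induction N with
    | zero => simp [qPoch_zero]
    | succ N ih => rw [ih, gaussSeries_eq b hc hq N, qPoch_succ]; ring
  have h2 : gaussSeries c b q 0 = qPochInf b q / qPochInf c q := by
    have h3 : Tendsto (fun _ : ℕ => gaussSeries c b q 0) atTop (𝓝 (gaussSeries c b q 0)) :=
      tendsto_const_nhds
    refine tendsto_nhds_unique (h3.congr h1) ?_
    rw [div_eq_mul_inv]
    exact (tendsto_qPoch b hq).mul (tendsto_gaussSeries b hc hq)
  rw [← h2]
  simpa [gaussSeries] using s0.hasSum

/-! ### Reciprocal factorials and conjugate Bailey pairs -/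

theorem HasSum.congr_of_eq {ι : Type*} {f g : ι → ℂ} {a b : ℂ} (h : HasSum f a)
    (hfg : ∀ i, g i = f i) (hab : b = a) : HasSum g b := by
  rw [hab, show g = f from funext hfg]
  exact h

/-- The reciprocal `1 / (p; p)_k`, extended by `0` to negative `k`. -/
def recipPoch (p : ℂ) (k : ℤ) : ℂ := if 0 ≤ k then (qPoch p p k.toNat)⁻¹ else 0

theorem recipPoch_natCast (p : ℂ) (k : ℕ) : recipPoch p k = (qPoch p p k)⁻¹ := by
  simp [recipPoch]

theorem recipPoch_of_neg (p : ℂ) {k : ℤ} (hk : k < 0) : recipPoch p k = 0 :=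
  if_neg (not_le.mpr hk)

/-- The extension by zero keeps the recurrence valid for every integer: at k = -1 the factor 1 - p^0
vanishes. -/
theorem recipPoch_eq_mul {p : ℂ} (hp : ‖p‖ < 1) (k : ℤ) :
    recipPoch p k = recipPoch p (k + 1) * (1 - p ^ (k + 1)) := by
  rcases lt_trichotomy k (-1) with h | rfl | h
  · rw [recipPoch_of_neg p (by omega), recipPoch_of_neg p (by omega), zero_mul]
  · simp [recipPoch]
  · lift k to ℕ using by omega
    have h1 : ((k : ℤ) + 1) = ((k + 1 : ℕ) : ℤ) := by push_cast; rfl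
    rw [h1, recipPoch_natCast, recipPoch_natCast, zpow_natCast, qPoch_succ, pow_succ' p k]
    have := qPoch_ne_zero hp hp k
    have := one_sub_mul_pow_ne_zero hp hp k
    generalize hv : 1 - p * p ^ k = v at *
    field_simp

theorem exists_recipPoch_bound {p : ℂ} (hp : ‖p‖ < 1) :
    ∃ C : ℝ, 0 ≤ C ∧ ∀ k, ‖recipPoch p k‖ ≤ C := by
  obtain ⟨C, hC0, hC⟩ := exists_qPoch_inv_bound hp hp
  refine ⟨C, hC0, fun k => ?_⟩
  unfold recipPoch
  split_ifs
  · exact hC _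
  · simpa using hC0

theorem tendsto_recipPoch {p : ℂ} (hp : ‖p‖ < 1) :
    Tendsto (recipPoch p) atTop (𝓝 (qPochInf p p)⁻¹) := by
  have h1 : Tendsto Int.toNat atTop atTop :=
    tendsto_atTop.mpr fun n => by
      filter_upwards [eventually_ge_atTop (n : ℤ)] with k hk
      omega
  have h2 := ((tendsto_qPoch p hp).inv₀ (qPochInf_ne_zero hp hp)).comp h1
  refine h2.congr' ?_
  filter_upwards [eventually_ge_atTop (0 : ℤ)] with k hk
  simp [recipPoch, hk]

/-- A conjugate Bailey pair relative to `p ^ d`. -/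
theorem hasSum_gaussNum_mul_recipPoch {p : ℂ} (b : ℂ) (hp : ‖p‖ < 1) (d r : ℕ) :
    HasSum (fun n : ℕ => gaussNum (p ^ (d + 1)) b p n *
        (recipPoch p ((n : ℤ) - r) * recipPoch p ((n : ℤ) + r + d)))
      (gaussNum (p ^ (d + 1)) b p r * qPochInf (b * p ^ r) p / qPochInf p p) := by
  have hc : ‖p ^ (d + 1) * p ^ (2 * r)‖ < 1 := by
    rw [← pow_add, norm_pow]
    exact pow_lt_one₀ (norm_nonneg _) hp (by omega)
  have h := (hasSum_gauss (b * p ^ r) hc hp).mul_left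
    (gaussNum (p ^ (d + 1)) b p r * (qPoch p p (2 * r + d))⁻¹)
  have e1 : p * p ^ (2 * r + d) = p ^ (d + 1) * p ^ (2 * r) := by ring
  -- Terms with n < r vanish. After n = r + k, the series is a q-Gauss series with parameters c
  -- p^{2r} and b p^r.
  rw [← hasSum_nat_add_iff' r, Finset.sum_eq_zero, sub_zero]
  · refine h.congr_of_eq (fun k => ?_) ?_
    · have e2 : ((k + r : ℕ) : ℤ) - r = (k : ℕ) := by push_cast; ring
      have e3 : ((k + r : ℕ) : ℤ) + r + d = ((2 * r + d + k : ℕ) : ℤ) := by push_cast; ring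
      rw [e2, e3, recipPoch_natCast, recipPoch_natCast, add_comm k r, gaussNum_add, qPoch_add, e1,
        mul_inv]
      ring
    · rw [qPochInf_eq_mul p hp (2 * r + d), e1]
      have := qPoch_ne_zero hp hp (2 * r + d)
      have := qPochInf_ne_zero hc hp
      field_simp
  · intro n hn
    rw [recipPoch_of_neg p (by have := Finset.mem_range.mp hn; omega)]
    simp

/-- Fubini for a double series with absolutely summable weights and a uniformly bounded kernel. -/
theorem hasSum_mul_of_hasSum_swap {ι : Type*} {A : ι → ℂ} {W : ℕ → ℂ} {k : ι → ℕ → ℂ}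
    {V : ι → ℂ} {L : ℕ → ℂ} {C : ℝ} {S : ℂ} (hA : Summable fun i => ‖A i‖)
    (hW : Summable fun n => ‖W n‖) (hk : ∀ i n, ‖k i n‖ ≤ C)
    (hV : ∀ i, HasSum (fun n => W n * k i n) (V i))
    (hL : ∀ n, HasSum (fun i => A i * k i n) (L n))
    (hS : HasSum (fun i => A i * V i) S) : HasSum (fun n => W n * L n) S := by
  have hs : Summable fun x : ι × ℕ => A x.1 * (W x.2 * k x.1 x.2) := by
    have h := (Summable.mul_of_nonneg hA hW (fun _ => norm_nonneg _)
      (fun _ => norm_nonneg _)).mul_right C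
    refine Summable.of_norm_bounded h fun x => ?_
    rw [norm_mul, norm_mul, ← mul_assoc]
    exact mul_le_mul_of_nonneg_left (hk _ _) (by positivity)
  have h1 := hs.hasSum.prod_fiberwise (fun i => (hV i).mul_left (A i))
  have h2 := (Equiv.prodComm ℕ ι).hasSum_iff.mpr hs.hasSum
  rw [h1.unique hS] at h2
  refine h2.prod_fiberwise (fun n => ?_)
  refine ((hL n).mul_left (W n)).congr_of_eq (fun i => ?_) rfl
  simp only [Function.comp, Equiv.prodComm_apply, Prod.swap]
  ring

/-! ### Theta series and the Jacobi triple product -/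

/-- The general term of Ramanujan's theta series `f(-x, -y)`. -/
def thetaTerm (x y : ℂ) (m : ℤ) : ℂ :=
  (-1) ^ m * x ^ (m * (m + 1) / 2) * y ^ (m * (m - 1) / 2)

theorem thetaTerm_zero (x y : ℂ) : thetaTerm x y 0 = 1 := by simp [thetaTerm]

theorem thetaTerm_neg (x y : ℂ) (m : ℤ) : thetaTerm x y (-m) = thetaTerm y x m := by
  have h1 : -m * (-m + 1) = m * (m - 1) := by ring
  have h2 : -m * (-m - 1) = m * (m + 1) := by ring
  rw [thetaTerm, thetaTerm, h1, h2]
  simp only [zpow_neg, ← inv_zpow, inv_neg, inv_one]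
  ring

theorem thetaTerm_succ {x y : ℂ} (hx : x ≠ 0) (hy : y ≠ 0) (m : ℤ) :
    thetaTerm x y (m + 1) = -(x * (x * y) ^ m) * thetaTerm x y m := by
  have h1 : (m + 1) * (m + 1 + 1) / 2 = m * (m + 1) / 2 + (m + 1) := by
    rw [show (m + 1) * (m + 1 + 1) = m * (m + 1) + (m + 1) * 2 by ring,
      Int.add_mul_ediv_right _ _ two_ne_zero]
  have h2 : (m + 1) * (m + 1 - 1) / 2 = m * (m - 1) / 2 + m := by
    rw [show (m + 1) * (m + 1 - 1) = m * (m - 1) + m * 2 by ring,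
      Int.add_mul_ediv_right _ _ two_ne_zero]
  rw [thetaTerm, thetaTerm, h1, h2, zpow_add₀ hx, zpow_add₀ hx, zpow_add₀ hy, mul_zpow,
    zpow_add₀ (by norm_num : (-1 : ℂ) ≠ 0), zpow_one, zpow_one]
  ring

theorem summable_norm_thetaTerm {x y : ℂ} (hx : x ≠ 0) (hy : y ≠ 0) (hxy : ‖x * y‖ < 1) :
    Summable fun m => ‖thetaTerm x y m‖ := by
  have main : ∀ {x y : ℂ}, x ≠ 0 → y ≠ 0 → ‖x * y‖ < 1 →
      Summable fun m : ℕ => ‖thetaTerm x y m‖ := by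
    intro x y hx hy hxy
    have h0 : Tendsto (fun m : ℕ => ‖x * (x * y) ^ m‖) atTop (𝓝 0) := by
      simpa using ((tendsto_pow_atTop_nhds_zero_of_norm_lt_one hxy).const_mul x).norm
    refine summable_of_ratio_norm_eventually_le (r := 1 / 2) (by norm_num) ?_
    filter_upwards [h0.eventually (gt_mem_nhds (by norm_num : (0 : ℝ) < 1 / 2))] with m hm
    rw [norm_norm, norm_norm, Nat.cast_succ, thetaTerm_succ hx hy, norm_mul, norm_neg, zpow_natCast]
    exact mul_le_mul_of_nonneg_right hm.le (norm_nonneg _)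
  refine Summable.of_nat_of_neg (main hx hy hxy) ?_
  simp only [thetaTerm_neg]
  exact main hy hx (by rwa [mul_comm])

/-- The q-Pascal rule applied twice. By `recipPoch_eq_mul` every product is a multiple of the one on
the left, leaving a polynomial identity in p^{n-m} and p^{n+m}. -/
theorem recipPoch_mul_recurrence {p : ℂ} (hp0 : p ≠ 0) (hp : ‖p‖ < 1) (n : ℕ) (m : ℤ) :
    (1 - p ^ (2 * n + 1)) * (1 - p ^ (2 * n + 2)) *
        (recipPoch p ((n + 1 : ℕ) - m) * recipPoch p ((n + 1 : ℕ) + m)) =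
      (1 + p ^ (2 * n + 1)) * (recipPoch p (n - m) * recipPoch p (n + m)) +
        p ^ ((n : ℤ) + 1 - m) * (recipPoch p (n - (m - 1)) * recipPoch p (n + (m - 1))) +
        p ^ ((n : ℤ) + 1 + m) * (recipPoch p (n - (m + 1)) * recipPoch p (n + (m + 1))) := by
  obtain ⟨a, ha⟩ : ∃ a : ℤ, a = n - m := ⟨_, rfl⟩
  obtain ⟨b, hb⟩ : ∃ b : ℤ, b = n + m := ⟨_, rfl⟩
  have e1 : p ^ (2 * n + 1) = p * (p ^ a * p ^ b) := by
    rw [← zpow_add₀ hp0, ← zpow_one_add₀ hp0, ← zpow_natCast]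
    congr 1
    push_cast
    omega
  have e2 : p ^ (2 * n + 2) = p * p * (p ^ a * p ^ b) := by rw [pow_succ, e1]; ring
  rw [e1, e2, show ((n + 1 : ℕ) : ℤ) - m = a + 1 by push_cast; omega,
    show ((n + 1 : ℕ) : ℤ) + m = b + 1 by push_cast; omega,
    show (n : ℤ) - (m - 1) = a + 1 by omega, show (n : ℤ) + (m - 1) = b - 1 by omega,
    show (n : ℤ) - (m + 1) = a - 1 by omega, show (n : ℤ) + (m + 1) = b + 1 by omega,
    show (n : ℤ) + 1 - m = a + 1 by omega, show (n : ℤ) + 1 + m = b + 1 by omega, ← ha, ← hb,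
    recipPoch_eq_mul hp (a - 1), recipPoch_eq_mul hp (b - 1), sub_add_cancel, sub_add_cancel,
    recipPoch_eq_mul hp a, recipPoch_eq_mul hp b, zpow_add_one₀ hp0, zpow_add_one₀ hp0]
  ring

/-- The finite triple product, by induction on n. Powers of p = xy in the recurrence shift the theta
terms by ±1, so the new factor is 1 + p^{2n+1} - (x+y)p^n = (1 - xp^n)(1 - yp^n). -/
theorem hasSum_thetaTerm_mul_recipPoch {x y : ℂ} (hx : x ≠ 0) (hy : y ≠ 0) (hxy : ‖x * y‖ < 1)
    (n : ℕ) :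
    HasSum (fun m : ℤ => thetaTerm x y m * (recipPoch (x * y) (n - m) * recipPoch (x * y) (n + m)))
      (qPoch x (x * y) n * qPoch y (x * y) n / qPoch (x * y) (x * y) (2 * n)) := by
  have hp0 : x * y ≠ 0 := mul_ne_zero hx hy
  induction n with
  | zero =>
    have h := hasSum_single (f := fun m : ℤ => thetaTerm x y m *
      (recipPoch (x * y) ((0 : ℕ) - m) * recipPoch (x * y) ((0 : ℕ) + m))) 0 fun m hm => by
        rcases lt_or_gt_of_ne hm with h | h
        · rw [recipPoch_of_neg _ (show ((0 : ℕ) : ℤ) + m < 0 by simpa using h)]; simp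
        · rw [recipPoch_of_neg _ (show ((0 : ℕ) : ℤ) - m < 0 by simpa using h)]; simp
    simpa [thetaTerm_zero, recipPoch, qPoch_zero] using h
  | succ n ih =>
    have h1 := ((Equiv.subRight (1 : ℤ)).hasSum_iff.mpr ih).mul_left (-(x * (x * y) ^ n))
    have h2 := ((Equiv.addRight (1 : ℤ)).hasSum_iff.mpr ih).mul_left (-(y * (x * y) ^ n))
    have h3 := ((ih.mul_left (1 + (x * y) ^ (2 * n + 1))).add h1).add h2
    have n1 := one_sub_mul_pow_ne_zero hxy hxy (2 * n)
    have n2 := one_sub_mul_pow_ne_zero hxy hxy (2 * n + 1)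
    rw [← pow_succ'] at n1 n2
    refine (h3.mul_left ((1 - (x * y) ^ (2 * n + 1)) * (1 - (x * y) ^ (2 * n + 2)))⁻¹).congr_of_eq
      (fun m => ?_) ?_
    · rw [eq_inv_mul_iff_mul_eq₀ (mul_ne_zero n1 n2), mul_left_comm,
        recipPoch_mul_recurrence hp0 hxy n m]
      simp only [Function.comp, Equiv.subRight_apply, Equiv.coe_addRight]
      have e1 : thetaTerm x y m * (x * y) ^ ((n : ℤ) + 1 - m) =
          -(x * (x * y) ^ n) * thetaTerm x y (m - 1) := by
        conv_lhs => rw [← sub_add_cancel m 1, thetaTerm_succ hx hy]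
        rw [← zpow_natCast, show (n : ℤ) = (m - 1) + ((n : ℤ) + 1 - m) by ring,
          zpow_add₀ hp0]
        ring_nf
      have e2 : thetaTerm x y m * (x * y) ^ ((n : ℤ) + 1 + m) =
          -(y * (x * y) ^ n) * thetaTerm x y (m + 1) := by
        rw [thetaTerm_succ hx hy, zpow_add₀ hp0, zpow_add₀ hp0, zpow_natCast, zpow_one]
        ring
      rw [mul_add, mul_add, ← mul_assoc _ ((x * y) ^ ((n : ℤ) + 1 - m)), e1,
        ← mul_assoc _ ((x * y) ^ ((n : ℤ) + 1 + m)), e2]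
      ring
    · have n3 := qPoch_ne_zero hxy hxy (2 * n)
      rw [show 2 * (n + 1) = 2 * n + 1 + 1 by ring, qPoch_succ x, qPoch_succ y,
        qPoch_succ (x * y), qPoch_succ (x * y), ← pow_succ', ← pow_succ']
      generalize hv : 1 - (x * y) ^ (2 * n + 1) = v at *
      generalize hw : 1 - (x * y) ^ (2 * n + 1 + 1) = w at *
      have hv' : (x * y) ^ (2 * n + 1) = x * y * ((x * y) ^ n) ^ 2 := by ring
      rw [hv']
      field_simp
      ring

/-- The Jacobi triple product identity. -/
theorem hasSum_thetaTerm {x y : ℂ} (hx : x ≠ 0) (hy : y ≠ 0) (hxy : ‖x * y‖ < 1) :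
    HasSum (thetaTerm x y) (qPochInf3 x y (x * y) (x * y)) := by
  have hs := summable_norm_thetaTerm hx hy hxy
  obtain ⟨C, hC0, hC⟩ := exists_recipPoch_bound hxy
  have hP := qPochInf_ne_zero hxy hxy
  -- Let n → ∞ in the finite form, by dominated convergence.
  have hlim : Tendsto (fun n : ℕ => ∑' m : ℤ, thetaTerm x y m *
      (recipPoch (x * y) (n - m) * recipPoch (x * y) (n + m))) atTop
      (𝓝 (∑' m : ℤ, thetaTerm x y m * ((qPochInf (x * y) (x * y))⁻¹ *
        (qPochInf (x * y) (x * y))⁻¹))) := by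
    refine tendsto_tsum_of_dominated_convergence (hs.mul_right (C * C)) (fun m => ?_)
      (Eventually.of_forall fun n m => ?_)
    · refine (Tendsto.mul ?_ ?_).const_mul _
      · exact (tendsto_recipPoch hxy).comp
          (tendsto_atTop_add_const_right _ (-m) tendsto_natCast_atTop_atTop)
      · exact (tendsto_recipPoch hxy).comp
          (tendsto_atTop_add_const_right _ m tendsto_natCast_atTop_atTop)
    · rw [norm_mul, norm_mul]
      exact mul_le_mul_of_nonneg_left (mul_le_mul (hC _) (hC _) (norm_nonneg _) hC0)
        (norm_nonneg _)
  have hlim2 : Tendsto (fun n : ℕ => qPoch x (x * y) n * qPoch y (x * y) n /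
      qPoch (x * y) (x * y) (2 * n)) atTop
      (𝓝 (qPochInf x (x * y) * qPochInf y (x * y) / qPochInf (x * y) (x * y))) :=
    ((tendsto_qPoch x hxy).mul (tendsto_qPoch y hxy)).div
      ((tendsto_qPoch (x * y) hxy).comp (tendsto_id.const_mul_atTop' two_pos)) hP
  have h := tendsto_nhds_unique
    (hlim.congr fun n => (hasSum_thetaTerm_mul_recipPoch hx hy hxy n).tsum_eq) hlim2
  rw [tsum_mul_right] at h
  have : qPochInf3 x y (x * y) (x * y) = ∑' m, thetaTerm x y m := by
    rw [qPochInf3]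
    field_simp at h
    rw [h]
    ring
  rw [this]
  exact hs.of_norm.hasSum

/-! ### Specialisation to powers of q -/

theorem norm_pow_lt_one {q : ℂ} (hq : ‖q‖ < 1) {k : ℕ} (hk : k ≠ 0) : ‖q ^ k‖ < 1 := by
  rw [norm_pow]
  exact pow_lt_one₀ (norm_nonneg _) hq hk

theorem one_add_pow_ne_zero {q : ℂ} (hq : ‖q‖ < 1) (k : ℕ) : 1 + q ^ (k + 1) ≠ 0 := by
  intro h
  have h1 := norm_pow_lt_one hq k.succ_ne_zero
  rw [Nat.succ_eq_add_one, eq_neg_of_add_eq_zero_right h] at h1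
  simp at h1

theorem thetaTerm_pow {q : ℂ} (hq0 : q ≠ 0) (a b : ℕ) (m e : ℤ)
    (he : 2 * e = a * (m * (m + 1)) + b * (m * (m - 1))) :
    thetaTerm (q ^ a) (q ^ b) m = (-1) ^ m * q ^ e := by
  obtain ⟨k, hk⟩ := (Int.even_mul_succ_self m).two_dvd
  have h1 : m * (m + 1) / 2 = k := by omega
  have h2 : m * (m - 1) = 2 * (k - m) := by linear_combination hk
  have h3 : m * (m - 1) / 2 = k - m := by omega
  have h4 : e = a * k + b * (k - m) := by
    rw [hk, h2] at he
    linarith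
  rw [thetaTerm, h1, h3, h4, zpow_add₀ hq0, zpow_mul, zpow_mul, zpow_natCast, zpow_natCast,
    mul_assoc]

theorem hasSum_thetaTerm_pow {q : ℂ} (hq0 : q ≠ 0) (hq : ‖q‖ < 1) {a b c : ℕ} (h : b + a = c)
    (hc : c ≠ 0) :
    HasSum (thetaTerm (q ^ a) (q ^ b)) (qPochInf3 (q ^ b) (q ^ a) (q ^ c) (q ^ c)) := by
  have e : q ^ a * q ^ b = q ^ c := by rw [← pow_add, add_comm, h]
  have := hasSum_thetaTerm (pow_ne_zero a hq0) (pow_ne_zero b hq0)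
    (by rw [e]; exact norm_pow_lt_one hq hc)
  rw [e] at this
  rwa [qPochInf3, mul_comm (qPochInf (q ^ b) _)]

theorem gaussBinom_eq {p : ℂ} (n : ℕ) (m : ℤ) :
    gaussBinom p (2 * n) ((n : ℤ) - 2 * m) =
      qPoch p p (2 * n) * (recipPoch p (n - 2 * m) * recipPoch p (n + 2 * m)) := by
  unfold gaussBinom
  by_cases h1 : 0 ≤ (n : ℤ) - 2 * m
  · by_cases h2 : 0 ≤ (n : ℤ) + 2 * m
    · rw [if_pos ⟨h1, by push_cast; omega⟩, recipPoch, recipPoch, if_pos h1, if_pos h2,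
        show 2 * n - ((n : ℤ) - 2 * m).toNat = ((n : ℤ) + 2 * m).toNat by omega, div_eq_mul_inv,
        mul_inv]
    · rw [if_neg (by push_cast; omega), recipPoch_of_neg p (not_le.mp h2)]
      simp
  · rw [if_neg (fun h => h1 h.1), recipPoch_of_neg p (not_le.mp h1)]
    simp

theorem hasSum_mul_recipPoch (p : ℂ) (c : ℤ → ℂ) (n : ℕ) :
    HasSum (fun m : ℤ => c m * (recipPoch p (n - 2 * m) * recipPoch p (n + 2 * m)))
      (∑ m ∈ Finset.Icc (-((n : ℤ) / 2)) ((n : ℤ) / 2),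
        c m * (recipPoch p (n - 2 * m) * recipPoch p (n + 2 * m))) := by
  refine hasSum_sum_of_ne_finset_zero fun m hm => ?_
  rw [Finset.mem_Icc, not_and_or] at hm
  rcases hm with hm | hm
  · rw [recipPoch_of_neg p (show (n : ℤ) + 2 * m < 0 by omega)]
    simp
  · rw [recipPoch_of_neg p (show (n : ℤ) - 2 * m < 0 by omega)]
    simp

theorem norm_mul_recipPoch_le {p : ℂ} {C : ℝ} (hC0 : 0 ≤ C) (hC : ∀ k, ‖recipPoch p k‖ ≤ C)
    (a b : ℤ) : ‖recipPoch p a * recipPoch p b‖ ≤ C * C := by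
  rw [norm_mul]
  exact mul_le_mul (hC _) (hC _) (norm_nonneg _) hC0

theorem gaussNum_sq_eq (q : ℂ) (n : ℕ) :
    gaussNum (q ^ 2) (-q) (q ^ 2) n = q ^ (n ^ 2) * qPoch (-q) (q ^ 2) n := by
  induction n with
  | zero => simp [gaussNum_zero, qPoch_zero]
  | succ n ih => rw [gaussNum_succ, qPoch_succ, ih]; ring

theorem gaussNum_triangular_eq (q : ℂ) (n : ℕ) :
    gaussNum ((q ^ 2) ^ 2) (-(q ^ 2)) (q ^ 2) n =
      q ^ (n ^ 2 + n) * qPoch (-(q ^ 2)) (q ^ 2) n := by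
  induction n with
  | zero => simp [gaussNum_zero, qPoch_zero]
  | succ n ih => rw [gaussNum_succ, qPoch_succ, ih]; ring

theorem gaussNum_zero_right_eq (q : ℂ) (n : ℕ) :
    gaussNum ((q ^ 2) ^ 2) 0 (q ^ 2) n = q ^ (2 * (n ^ 2 + n)) := by
  induction n with
  | zero => simp [gaussNum_zero]
  | succ n ih => rw [gaussNum_succ, ih]; ring

/-- This and `qPoch_sq_eq_mul` cancel the factors (-q;q²)_n and (-q²;q²)_n carried by the q-Gauss
weights, leaving the stated denominators. -/
theorem qPoch_sq_two_mul (q : ℂ) (n : ℕ) :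
    qPoch (q ^ 2) (q ^ 2) (2 * n) =
      qPoch q (q ^ 2) n * qPoch (-q) (q ^ 2) n * qPoch (q ^ 4) (q ^ 4) n := by
  induction n with
  | zero => simp [qPoch_zero]
  | succ n ih =>
    rw [show 2 * (n + 1) = 2 * n + 1 + 1 by ring, qPoch_succ (q ^ 2), qPoch_succ (q ^ 2), ih,
      qPoch_succ, qPoch_succ, qPoch_succ]
    ring

theorem qPoch_sq_eq_mul (q : ℂ) (n : ℕ) :
    qPoch (q ^ 2) (q ^ 2) (2 * n) =
      qPoch q q (2 * n) * qPoch (-q) (q ^ 2) n * qPoch (-(q ^ 2)) (q ^ 2) n := by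
  induction n with
  | zero => simp [qPoch_zero]
  | succ n ih =>
    rw [show 2 * (n + 1) = 2 * n + 1 + 1 by ring, qPoch_succ (q ^ 2), qPoch_succ (q ^ 2), ih,
      qPoch_succ q, qPoch_succ q, qPoch_succ, qPoch_succ]
    ring

/-! ### The first identity -/

theorem hasSum_bailey_sq {q : ℂ} (hq0 : q ≠ 0) (hq : ‖q‖ < 1) :
    HasSum (fun n : ℕ => gaussNum (q ^ 2) (-q) (q ^ 2) n *
        ∑ m ∈ Finset.Icc (-((n : ℤ) / 2)) ((n : ℤ) / 2), thetaTerm (q ^ 5) (q ^ 4) m *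
          (recipPoch (q ^ 2) (n - 2 * m) * recipPoch (q ^ 2) (n + 2 * m)))
      (qPochInf (-q) (q ^ 2) * qPochInf3 (q ^ 8) (q ^ 9) (q ^ 17) (q ^ 17)
        / qPochInf (q ^ 2) (q ^ 2)) := by
  have hp := norm_pow_lt_one hq two_ne_zero
  obtain ⟨C, hC0, hC⟩ := exists_recipPoch_bound hp
  refine hasSum_mul_of_hasSum_swap
    (V := fun m => q ^ (4 * m ^ 2) * (qPochInf (-q) (q ^ 2) / qPochInf (q ^ 2) (q ^ 2)))
    (summable_norm_thetaTerm (pow_ne_zero 5 hq0) (pow_ne_zero 4 hq0)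
      (by rw [← pow_add]; exact norm_pow_lt_one hq (by norm_num)))
    (summable_norm_gaussNum _ _ hp) (fun m n => norm_mul_recipPoch_le hC0 hC _ _) (fun m => ?_)
    (fun n => hasSum_mul_recipPoch _ _ n) ?_
  · have h := hasSum_gaussNum_mul_recipPoch (-q) hp 0 (2 * m.natAbs)
    rw [zero_add, pow_one] at h
    refine h.congr_of_eq (fun n => ?_) ?_
    · rcases Int.natAbs_eq m with hm | hm
      · rw [show (n : ℤ) - (2 * m.natAbs : ℕ) = n - 2 * m by omega,
          show (n : ℤ) + (2 * m.natAbs : ℕ) + (0 : ℕ) = n + 2 * m by omega]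
      · rw [show (n : ℤ) - (2 * m.natAbs : ℕ) = n + 2 * m by omega,
          show (n : ℤ) + (2 * m.natAbs : ℕ) + (0 : ℕ) = n - 2 * m by omega,
          mul_comm (recipPoch _ _)]
    · rw [gaussNum_sq_eq, qPochInf_eq_mul (-q) hp (2 * m.natAbs),
        ← zpow_natCast q ((2 * m.natAbs) ^ 2),
        show (((2 * m.natAbs) ^ 2 : ℕ) : ℤ) = 4 * m ^ 2 by
          push_cast; rw [mul_pow, sq_abs]; norm_num]
      ring
  · refine ((hasSum_thetaTerm_pow (a := 9) (b := 8) (c := 17) hq0 hq rfl (by norm_num)).mul_right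
      (qPochInf (-q) (q ^ 2) / qPochInf (q ^ 2) (q ^ 2))).congr_of_eq (fun m => ?_) (by ring)
    -- The n-sum contributes q^{4m²}, raising the exponent m(9m+1)/2 to m(17m+1)/2.
    obtain ⟨k, hk⟩ := (Int.even_mul_succ_self m).two_dvd
    rw [thetaTerm_pow hq0 5 4 m (k + 4 * m ^ 2) (by push_cast; linear_combination -hk),
      thetaTerm_pow hq0 9 8 m (k + 4 * m ^ 2 + 4 * m ^ 2)
        (by push_cast; linear_combination -hk),
      zpow_add₀ hq0 (k + 4 * m ^ 2)]
    ring

/-! ### Removing the factor 1 + q^{2n+1} -/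

/-- Over the common factor 1/((p;p)_{n-r} (p;p)_{n+r+1}), p = q², the numerator is (1 - Xz) - z(1 -
X/z) = (1 - z)(1 + X), where X = q^{2n+1} and z = q^{2r+1}. Hence 1 + X cancels. -/
theorem recipPoch_telescope {q : ℂ} (hq0 : q ≠ 0) (hq : ‖q‖ < 1) (n : ℕ) (r : ℤ) :
    q ^ (r ^ 2) * (recipPoch (q ^ 2) (n - r) * recipPoch (q ^ 2) (n + r)) / (1 + q ^ (2 * n + 1)) -
      q ^ ((r + 1) ^ 2) * (recipPoch (q ^ 2) (n - (r + 1)) * recipPoch (q ^ 2) (n + (r + 1))) /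
        (1 + q ^ (2 * n + 1)) =
      q ^ (r ^ 2) * (1 - q ^ (2 * r + 1)) *
        (recipPoch (q ^ 2) (n - r) * recipPoch (q ^ 2) (n + r + 1)) := by
  have hp := norm_pow_lt_one hq two_ne_zero
  have h1 := recipPoch_eq_mul hp (n + r)
  have h2 := recipPoch_eq_mul hp (n - (r + 1))
  rw [show (n : ℤ) - (r + 1) + 1 = n - r by ring] at h2
  have e1 : (q ^ 2) ^ ((n : ℤ) + r + 1) = q ^ (2 * n + 1) * q ^ (2 * r + 1) := by
    rw [← zpow_natCast q 2, ← zpow_mul, ← zpow_natCast q (2 * n + 1), ← zpow_add₀ hq0]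
    congr 1
    push_cast
    ring
  have e2 : (q ^ 2) ^ ((n : ℤ) - r) * q ^ (2 * r + 1) = q ^ (2 * n + 1) := by
    rw [← zpow_natCast q 2, ← zpow_mul, ← zpow_natCast q (2 * n + 1), ← zpow_add₀ hq0]
    congr 1
    push_cast
    ring
  have e3 : q ^ ((r + 1) ^ 2) = q ^ (r ^ 2) * q ^ (2 * r + 1) := by
    rw [← zpow_add₀ hq0]
    congr 1
    ring
  have hX := one_add_pow_ne_zero hq (2 * n)
  rw [← sub_div, div_eq_iff hX, h1, h2, e1, e3, ← add_assoc]
  generalize (q ^ 2) ^ ((n : ℤ) - r) = P at *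
  rw [← e2]
  ring

theorem thetaTerm_one_right_neg_succ {q : ℂ} (hq0 : q ≠ 0) (m : ℤ) :
    thetaTerm q 1 (-(m + 1)) = -thetaTerm q 1 m := by
  rw [thetaTerm_neg, thetaTerm_succ one_ne_zero hq0, one_mul, one_mul, thetaTerm, thetaTerm,
    one_zpow, one_zpow, mul_one, mul_one]
  have : m * (m + 1) / 2 = m + m * (m - 1) / 2 := by
    rw [show m * (m + 1) = m * 2 + m * (m - 1) by ring, Int.add_comm,
      Int.add_mul_ediv_right _ _ two_ne_zero, add_comm]
  rw [this, zpow_add₀ hq0]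
  ring

theorem thetaTerm_pow_eq_one_right_mul {q : ℂ} (hq0 : q ≠ 0) {a b : ℕ} {m e : ℤ}
    (h : 2 * e = (a - 1) * (m * (m + 1)) + b * (m * (m - 1))) :
    thetaTerm (q ^ a) (q ^ b) m = thetaTerm q 1 m * q ^ e := by
  obtain ⟨k, hk⟩ := (Int.even_mul_succ_self m).two_dvd
  have h1 := thetaTerm_pow hq0 1 0 m k (by push_cast; linear_combination -hk)
  rw [pow_one, pow_zero] at h1
  rw [thetaTerm_pow hq0 a b m (k + e) (by linear_combination h - hk), h1, zpow_add₀ hq0]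
  ring

/-- Pairing m with -(m+1) gives kernels at r = 2m and r = 2m+2 with opposite signs; the two summands
are the telescoping steps from 2m to 2m+1 and from 2m+1 to 2m+2. -/
theorem hasSum_theta_mul_recipPoch_div {q : ℂ} (hq0 : q ≠ 0) (hq : ‖q‖ < 1) (n : ℕ) :
    HasSum (fun m : ℕ => thetaTerm q 1 m *
        (q ^ ((2 * m) ^ 2) * (1 - q ^ (4 * m + 1)) * (recipPoch (q ^ 2) (n - (2 * m : ℕ)) *
            recipPoch (q ^ 2) (n + (2 * m : ℕ) + 1)) +
          q ^ ((2 * m + 1) ^ 2) * (1 - q ^ (4 * m + 3)) *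
            (recipPoch (q ^ 2) (n - (2 * m + 1 : ℕ)) *
              recipPoch (q ^ 2) (n + (2 * m + 1 : ℕ) + 1))))
      ((∑ m ∈ Finset.Icc (-((n : ℤ) / 2)) ((n : ℤ) / 2), thetaTerm (q ^ 5) (q ^ 4) m *
          (recipPoch (q ^ 2) (n - 2 * m) * recipPoch (q ^ 2) (n + 2 * m))) /
        (1 + q ^ (2 * n + 1))) := by
  have h := ((hasSum_mul_recipPoch (q ^ 2) (thetaTerm (q ^ 5) (q ^ 4)) n).div_const
    (1 + q ^ (2 * n + 1))).nat_add_neg_add_one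
  refine h.congr_of_eq (fun m => ?_) rfl
  have t1 := recipPoch_telescope hq0 hq n (2 * m)
  have t2 := recipPoch_telescope hq0 hq n (2 * m + 1)
  have z1 : q ^ ((2 * m) ^ 2) = q ^ ((2 * (m : ℤ)) ^ 2) := by
    rw [← zpow_natCast]; push_cast; rfl
  have z2 : q ^ ((2 * m + 1) ^ 2) = q ^ ((2 * (m : ℤ) + 1) ^ 2) := by
    rw [← zpow_natCast]; push_cast; rfl
  have z3 : q ^ (4 * m + 1) = q ^ (2 * (2 * (m : ℤ)) + 1) := by
    rw [← zpow_natCast]; congr 1; push_cast; ring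
  have z4 : q ^ (4 * m + 3) = q ^ (2 * (2 * (m : ℤ) + 1) + 1) := by
    rw [← zpow_natCast]; congr 1; push_cast; ring
  rw [z1, z2, z3, z4]
  push_cast
  rw [← t1, ← t2,
    thetaTerm_pow_eq_one_right_mul hq0 (e := (2 * (m : ℤ)) ^ 2) (by push_cast; ring),
    thetaTerm_pow_eq_one_right_mul hq0 (m := -((m : ℤ) + 1)) (e := (2 * (m : ℤ) + 1 + 1) ^ 2)
      (by push_cast; ring),
    thetaTerm_one_right_neg_succ hq0,
    show (n : ℤ) - 2 * (-((m : ℤ) + 1)) = n + (2 * m + 1 + 1) by ring,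
    show (n : ℤ) + 2 * (-((m : ℤ) + 1)) = n - (2 * m + 1 + 1) by ring]
  ring

/-- Of the four expanded terms, the outer two are the terms m and -(m+1) of the first theta series;
the inner two are those of the second, multiplied by -q. -/
theorem hasSum_theta_pair {q : ℂ} (hq0 : q ≠ 0) (hq : ‖q‖ < 1) (e : ℕ) :
    HasSum (fun m : ℕ => thetaTerm q 1 m *
        (q ^ ((2 * m) ^ 2) * (1 - q ^ (4 * m + 1)) * q ^ (e * ((2 * m) ^ 2 + 2 * m)) +
          q ^ ((2 * m + 1) ^ 2) * (1 - q ^ (4 * m + 3)) *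
            q ^ (e * ((2 * m + 1) ^ 2 + (2 * m + 1)))))
      (qPochInf3 (q ^ (4 + 2 * e)) (q ^ (5 + 6 * e)) (q ^ (9 + 8 * e)) (q ^ (9 + 8 * e)) -
        q * qPochInf3 (q ^ (2 * e)) (q ^ (9 + 6 * e)) (q ^ (9 + 8 * e)) (q ^ (9 + 8 * e))) := by
  have h1 := (hasSum_thetaTerm_pow (a := 5 + 6 * e) (b := 4 + 2 * e) (c := 9 + 8 * e) hq0 hq
    (by ring) (by omega)).nat_add_neg_add_one
  have h2 := (hasSum_thetaTerm_pow (a := 9 + 6 * e) (b := 2 * e) (c := 9 + 8 * e) hq0 hq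
    (by ring) (by omega)).nat_add_neg_add_one
  refine (h1.sub (h2.mul_left q)).congr_of_eq (fun m => ?_) rfl
  rw [thetaTerm_pow_eq_one_right_mul hq0 (m := (m : ℤ))
      (e := (4 * m ^ 2 + e * (4 * m ^ 2 + 2 * m) : ℕ)) (by push_cast; ring),
    thetaTerm_pow_eq_one_right_mul hq0 (m := -((m : ℤ) + 1))
      (e := (4 * m ^ 2 + 8 * m + 4 + e * (4 * m ^ 2 + 6 * m + 2) : ℕ)) (by push_cast; ring),
    thetaTerm_pow_eq_one_right_mul hq0 (m := (m : ℤ))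
      (e := (4 * m ^ 2 + 4 * m + e * (4 * m ^ 2 + 2 * m) : ℕ)) (by push_cast; ring),
    thetaTerm_pow_eq_one_right_mul hq0 (m := -((m : ℤ) + 1))
      (e := (4 * m ^ 2 + 4 * m + e * (4 * m ^ 2 + 6 * m + 2) : ℕ)) (by push_cast; ring),
    thetaTerm_one_right_neg_succ hq0]
  simp only [zpow_natCast]
  ring

/-- The hypothesis on K says that the conjugate Bailey pair depends on s only through q^{e(s²+s)}.
The choice b = 0 gives e = 2, and b = -q² gives e = 1. -/
theorem hasSum_bailey_div {q b K : ℂ} (hq0 : q ≠ 0) (hq : ‖q‖ < 1) (e : ℕ)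
    (hK : ∀ s : ℕ, gaussNum ((q ^ 2) ^ 2) b (q ^ 2) s * qPochInf (b * (q ^ 2) ^ s) (q ^ 2) =
      q ^ (e * (s ^ 2 + s)) * K) :
    HasSum (fun n : ℕ => gaussNum ((q ^ 2) ^ 2) b (q ^ 2) n *
        ((∑ m ∈ Finset.Icc (-((n : ℤ) / 2)) ((n : ℤ) / 2), thetaTerm (q ^ 5) (q ^ 4) m *
          (recipPoch (q ^ 2) (n - 2 * m) * recipPoch (q ^ 2) (n + 2 * m))) /
        (1 + q ^ (2 * n + 1))))
      (K / qPochInf (q ^ 2) (q ^ 2) *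
        (qPochInf3 (q ^ (4 + 2 * e)) (q ^ (5 + 6 * e)) (q ^ (9 + 8 * e)) (q ^ (9 + 8 * e)) -
        q * qPochInf3 (q ^ (2 * e)) (q ^ (9 + 6 * e)) (q ^ (9 + 8 * e)) (q ^ (9 + 8 * e)))) := by
  have hp := norm_pow_lt_one hq two_ne_zero
  obtain ⟨C, hC0, hC⟩ := exists_recipPoch_bound hp
  have hA : Summable fun m : ℕ => ‖thetaTerm q 1 m‖ :=
    (summable_norm_thetaTerm hq0 one_ne_zero (by simpa using hq)).comp_injective Nat.cast_injective
  have hb : ∀ (i j : ℕ) (a c : ℤ), ‖q ^ i * (1 - q ^ j) *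
      (recipPoch (q ^ 2) a * recipPoch (q ^ 2) c)‖ ≤ 2 * (C * C) := by
    intro i j a c
    have h1 : ∀ l : ℕ, ‖q ^ l‖ ≤ 1 := fun l => by
      rw [norm_pow]; exact pow_le_one₀ (norm_nonneg _) hq.le
    have h2 : ‖1 - q ^ j‖ ≤ 2 := (norm_sub_le _ _).trans (by
      rw [norm_one]; linarith [h1 j])
    have h3 : ‖q ^ i * (1 - q ^ j)‖ ≤ 2 := by
      rw [norm_mul]
      exact (mul_le_of_le_one_left (norm_nonneg _) (h1 i)).trans h2
    rw [norm_mul]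
    exact mul_le_mul h3 (norm_mul_recipPoch_le hC0 hC _ _) (norm_nonneg _) zero_le_two
  have hv : ∀ s : ℕ, HasSum (fun n : ℕ => gaussNum ((q ^ 2) ^ 2) b (q ^ 2) n *
      (recipPoch (q ^ 2) (n - s) * recipPoch (q ^ 2) (n + s + 1)))
      (q ^ (e * (s ^ 2 + s)) * (K / qPochInf (q ^ 2) (q ^ 2))) := by
    intro s
    have h := hasSum_gaussNum_mul_recipPoch b hp 1 s
    rw [one_add_one_eq_two, hK, mul_div_assoc] at h
    exact_mod_cast h
  refine hasSum_mul_of_hasSum_swap hA (summable_norm_gaussNum _ _ hp)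
    (fun m n => (norm_add_le _ _).trans (add_le_add (hb _ _ _ _) (hb _ _ _ _)))
    (fun m => ?_) (fun n => hasSum_theta_mul_recipPoch_div hq0 hq n)
    (((hasSum_theta_pair hq0 hq e).mul_left (K / qPochInf (q ^ 2) (q ^ 2))).congr_of_eq
      (fun m => mul_left_comm _ _ _) rfl)
  refine (((hv (2 * m)).mul_left (q ^ ((2 * m) ^ 2) * (1 - q ^ (4 * m + 1)))).add
    ((hv (2 * m + 1)).mul_left (q ^ ((2 * m + 1) ^ 2) * (1 - q ^ (4 * m + 3))))).congr_of_eq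
    (fun n => ?_) ?_ <;> ring

/-! ### Assembling the three identities -/

theorem hasSum_one_of_support {f : ℕ → ℂ} (h0 : f 0 = 1) (h : ∀ n, n ≠ 0 → f n = 0) :
    HasSum f 1 := h0 ▸ hasSum_single 0 h

theorem zero_zpow_add_theta_exponent {a m : ℤ} (ha : 0 < a) :
    (0 : ℂ) ^ (a + m * (9 * m + 1) / 2) = 0 := by
  have h : 0 ≤ m * (9 * m + 1) := by
    rcases le_or_gt 0 m with h | h
    · positivity
    · exact mul_nonneg_of_nonpos_of_nonpos h.le (by omega)
  exact zero_zpow _ (by have := Int.ediv_nonneg h zero_le_two; omega)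

theorem zpow_add_theta_exponent {q : ℂ} (hq0 : q ≠ 0) (a : ℕ) (m : ℤ) :
    (-1 : ℂ) ^ m * q ^ ((a : ℤ) + m * (9 * m + 1) / 2) =
      q ^ a * thetaTerm (q ^ 5) (q ^ 4) m := by
  have h : 2 * (m * (9 * m + 1) / 2) = m * (9 * m + 1) := by
    obtain ⟨k, hk⟩ := (Int.even_mul_succ_self m).two_dvd
    rw [show m * (9 * m + 1) = 2 * (k + 4 * m ^ 2) by linear_combination hk]
    omega
  rw [thetaTerm_pow hq0 5 4 m (m * (9 * m + 1) / 2) (by push_cast; linear_combination h),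
    zpow_add₀ hq0, zpow_natCast]
  ring

theorem qPochInf_zero_left (q : ℂ) : qPochInf 0 q = 1 := by simp [qPochInf]

theorem mainTheorem3 (q : ℂ) (hq : ‖q‖ < 1) :
    HasSum
        (fun n : ℕ => ∑ m ∈ Finset.Icc (-((n : ℤ) / 2)) ((n : ℤ) / 2),
          (-1 : ℂ) ^ m * q ^ ((n : ℤ) ^ 2 + m * (9 * m + 1) / 2)
            / (qPoch q (q ^ 2) n * qPoch (q ^ 4) (q ^ 4) n)
            * gaussBinom (q ^ 2) (2 * n) ((n : ℤ) - 2 * m))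
        (qPochInf (-q) (q ^ 2) * qPochInf3 (q ^ 8) (q ^ 9) (q ^ 17) (q ^ 17)
          / qPochInf (q ^ 2) (q ^ 2)) ∧
    HasSum
        (fun n : ℕ => ∑ m ∈ Finset.Icc (-((n : ℤ) / 2)) ((n : ℤ) / 2),
          (-1 : ℂ) ^ m * q ^ (2 * (n : ℤ) * ((n : ℤ) + 1) + m * (9 * m + 1) / 2)
            / ((1 + q ^ (2 * n + 1)) * qPoch (q ^ 2) (q ^ 2) (2 * n))
            * gaussBinom (q ^ 2) (2 * n) ((n : ℤ) - 2 * m))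
        (1 / qPochInf (q ^ 2) (q ^ 2)
          * (qPochInf3 (q ^ 8) (q ^ 17) (q ^ 25) (q ^ 25)
            - q * qPochInf3 (q ^ 4) (q ^ 21) (q ^ 25) (q ^ 25))) ∧
    HasSum
        (fun n : ℕ => ∑ m ∈ Finset.Icc (-((n : ℤ) / 2)) ((n : ℤ) / 2),
          (-1 : ℂ) ^ m * q ^ ((n : ℤ) * ((n : ℤ) + 1) + m * (9 * m + 1) / 2)
            / (qPoch q q (2 * n) * qPoch (-q) (q ^ 2) (n + 1))
            * gaussBinom (q ^ 2) (2 * n) ((n : ℤ) - 2 * m))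
        (qPochInf (-(q ^ 2)) (q ^ 2) / qPochInf (q ^ 2) (q ^ 2)
          * (qPochInf3 (q ^ 6) (q ^ 11) (q ^ 17) (q ^ 17)
            - q * qPochInf3 (q ^ 2) (q ^ 15) (q ^ 17) (q ^ 17))) := by
  -- The theta-term lemmas divide by q, so q = 0 is separate: only n = 0 survives and all sums equal
  -- 1.
  rcases eq_or_ne q 0 with rfl | hq0
  · have e1 : ∀ n : ℕ, n ≠ 0 → ∀ m : ℤ, (0 : ℂ) ^ ((n : ℤ) ^ 2 + m * (9 * m + 1) / 2) = 0 :=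
      fun n hn m => zero_zpow_add_theta_exponent (by positivity)
    have e2 : ∀ n : ℕ, n ≠ 0 → ∀ m : ℤ,
        (0 : ℂ) ^ (2 * (n : ℤ) * ((n : ℤ) + 1) + m * (9 * m + 1) / 2) = 0 :=
      fun n hn m => zero_zpow_add_theta_exponent (by positivity)
    have e3 : ∀ n : ℕ, n ≠ 0 → ∀ m : ℤ,
        (0 : ℂ) ^ ((n : ℤ) * ((n : ℤ) + 1) + m * (9 * m + 1) / 2) = 0 :=
      fun n hn m => zero_zpow_add_theta_exponent (by positivity)
    simp only [ne_eq, OfNat.ofNat_ne_zero, not_false_eq_true, zero_pow, neg_zero, qPochInf3,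
      qPochInf_zero_left, mul_one, div_one, sub_zero]
    refine ⟨hasSum_one_of_support ?_ fun n hn => ?_, hasSum_one_of_support ?_ fun n hn => ?_,
      hasSum_one_of_support ?_ fun n hn => ?_⟩
    · simp [qPoch, gaussBinom]
    · exact Finset.sum_eq_zero fun m _ => by rw [e1 n hn]; simp
    · simp [qPoch, gaussBinom]
    · exact Finset.sum_eq_zero fun m _ => by rw [e2 n hn]; simp
    · simp [qPoch, gaussBinom]
    · exact Finset.sum_eq_zero fun m _ => by rw [e3 n hn]; simp
  have hp := norm_pow_lt_one hq two_ne_zero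
  have hP := qPoch_ne_zero hp hp
  refine ⟨(hasSum_bailey_sq hq0 hq).congr_of_eq (fun n => ?_) rfl, ?_, ?_⟩
  · rw [Finset.mul_sum]
    refine Finset.sum_congr rfl fun m _ => ?_
    have h := hP (2 * n)
    have h1 := qPoch_sq_two_mul q n
    rw [h1] at h
    obtain ⟨⟨n1, n2⟩, n3⟩ := (mul_ne_zero_iff.mp h).imp_left mul_ne_zero_iff.mp
    have h2 := zpow_add_theta_exponent hq0 (n ^ 2) m
    rw [Nat.cast_pow] at h2
    rw [h2, gaussBinom_eq, h1, gaussNum_sq_eq]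
    field_simp
  · refine (hasSum_bailey_div (b := 0) (K := 1) hq0 hq 2 fun s => ?_).congr_of_eq (fun n => ?_) rfl
    · rw [gaussNum_zero_right_eq, zero_mul, qPochInf_zero_left]
    · rw [Finset.sum_div, Finset.mul_sum]
      refine Finset.sum_congr rfl fun m _ => ?_
      have h := hP (2 * n)
      have hX := one_add_pow_ne_zero hq (2 * n)
      have h2 := zpow_add_theta_exponent hq0 (2 * (n ^ 2 + n)) m
      rw [show ((2 * (n ^ 2 + n) : ℕ) : ℤ) = 2 * (n : ℤ) * ((n : ℤ) + 1) by push_cast; ring] at h2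
      rw [h2, gaussBinom_eq, gaussNum_zero_right_eq]
      field_simp
  · refine (hasSum_bailey_div (b := -(q ^ 2)) (K := qPochInf (-(q ^ 2)) (q ^ 2)) hq0 hq 1
      fun s => ?_).congr_of_eq (fun n => ?_) rfl
    · rw [gaussNum_triangular_eq, one_mul, qPochInf_eq_mul (-(q ^ 2)) hp s, mul_assoc]
    · rw [Finset.sum_div, Finset.mul_sum]
      refine Finset.sum_congr rfl fun m _ => ?_
      have h := hP (2 * n)
      have h1 := qPoch_sq_eq_mul q n
      rw [h1] at h
      obtain ⟨⟨n1, n2⟩, n3⟩ := (mul_ne_zero_iff.mp h).imp_left mul_ne_zero_iff.mp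
      have hX := one_add_pow_ne_zero hq (2 * n)
      have h2 := zpow_add_theta_exponent hq0 (n ^ 2 + n) m
      rw [show ((n ^ 2 + n : ℕ) : ℤ) = (n : ℤ) * ((n : ℤ) + 1) by push_cast; ring] at h2
      have h3 : 1 - -q * (q ^ 2) ^ n = 1 + q ^ (2 * n + 1) := by ring
      rw [h2, gaussBinom_eq, h1, gaussNum_triangular_eq, qPoch_succ, h3]
      field_simp

end
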